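/- Let $\mathbf F_q$ be a finite field with $q$ elements and characteristic $p$, and let $n=\prod_i p_i^{m_i}>1$ be an odd integer coprime to $q$, where the $p_i$ are distinct primes (the index set being non-empty). Assume that $q$ is a quadratic residue modulo each $p_i$. Let $t_i=\operatorname{ord}_{p_i}(q)$ be the multiplicative order of $q$ modulo $p_i$, let $z_i$ be such that $p_i^{z_i}\,\|\,q^{t_i}-1$ (that is, $p_i^{z_i}$ divides $q^{t_i}-1$ but $p_i^{z_i+1}$ does not), and suppose that $m_i>2z_i$ for all $i$. Then there are integers $d,d'$ and an odd-like duadic code $D\subseteq\mathbf F_q^n$ with even-like subcode $C$ such that the CSS code $Q$ of $C\subseteq D$ is a degenerate $[[n,1,d]]_q$ quantum stabilizer code, $d'$ is the largest integer such that $Q$ is pure to $d'$, and $$d'\le \min_i p_i^{z_i}<d,\qquad d^2\ge n .$$ If moreover $p_i\equiv -1 \pmod 4$ for every $i$, then this code also satisfies $d^2-d+1\ge n$. Here the following definitions are used. *Duadic codes.* $D$ is an odd-like duadic code if $D=\{c\in\mathbf F_q^n : c(\alpha^j)=0 \text{ for all } j\in S_0\}$, where $c(x)=\sum_{i=0}^{n-1}c_ix^i$,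 $\alpha$ is a primitive $n$-th root of unity in the algebraic closure of $\mathbf F_q$, and $S_0$ belongs to a splitting: $S_0,S_1$ are unions of $q$-ary cyclotomic cosets modulo $n$ that partition the nonzero residues modulo $n$, and multiplication by some $a$ coprime to $n$ interchanges $S_0$ and $S_1$. Its even-like subcode is $C=\{c\in D:\sum_i c_i=0\}$. *Errors.* On $\mathbf C^{q^n}$ with orthonormal basis $|x\rangle$, $x\in\mathbf F_q^n$, let $X(a)|x\rangle=|x+a\rangle$ and $Z(b)|x\rangle=e^{2\pi i\,\mathrm{tr}(b\cdot x)/p}|x\rangle$ for $a,b\in\mathbf F_q^n$, where $\mathrm{tr}$ is the trace from $\mathbf F_q$ to $\mathbf F_p$. The errors are the operators $E=X(a)Z(b)$; the weight of $E$ is the number of coordinates $i$ with $(a_i,b_i)\ne(0,0)$. The error group is the group generated by all errors. *Quantum codes.* A subspace $Q$ of $\mathbf C^{q^n}$ is a stabilizer code if it is the joint $+1$-eigenspace of an abelian subgroup of the error group. The CSS code of $C\subseteq D$ is the joint $+1$-eigenspace of all $X(c)$, $c\in C$, and all $Z(b)$, $b\in D^\perp$, where $D^\perp$ is the Euclidean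 dual. An $[[n,k,d]]_q$ stabilizer code is a stabilizer code of dimension $q^k$ for which $d$ is the largest integer such that $\langle u|E|u\rangle=\langle v|E|v\rangle$ for all unit vectors $u,v\in Q$ and all errors $E$ of weight less than $d$. $Q$ is pure to $t$ if $\langle v|E|v\rangle=q^{-n}\operatorname{tr}E$ for all unit vectors $v\in Q$ and all errors $E$ of weight less than $t$. An $[[n,k,d]]_q$ code is degenerate if it is not pure to $d$. -/

import Mathlib

namespace DuadicQuantum

/-! ### Classical codes of length `n` over a finite field `F` -/

section Classical

variable {F : Type*} [Field F] {n : ℕ}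

/-- The Euclidean dual code `C^⊥`. -/
def dualCode (C : Submodule F (Fin n → F)) : Submodule F (Fin n → F) where
  carrier := {b | ∀ c ∈ C, ∑ i, b i * c i = 0}
  add_mem' := by
    intro b b' hb hb' c hc
    simp only [Pi.add_apply, add_mul, Finset.sum_add_distrib, hb c hc, hb' c hc, add_zero]
  zero_mem' := by intro c _; simp
  smul_mem' := by
    intro s b hb c hc
    simp only [Pi.smul_apply, smul_eq_mul, mul_assoc, ← Finset.mul_sum, hb c hc, mul_zero]

/-- The even-like subcode of `D`: all codewords whose coordinates sum to zero. -/
def evenLikeSubcode (D : Submodule F (Fin n → F)) : Submodule F (Fin n → F) where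
  carrier := {c | c ∈ D ∧ ∑ i, c i = 0}
  add_mem' := by
    rintro c c' ⟨hc, h⟩ ⟨hc', h'⟩
    refine ⟨D.add_mem hc hc', ?_⟩
    simp only [Pi.add_apply, Finset.sum_add_distrib, h, h', add_zero]
  zero_mem' := ⟨D.zero_mem, by simp⟩
  smul_mem' := by
    rintro s c ⟨hc, h⟩
    refine ⟨D.smul_mem s hc, ?_⟩
    simp only [Pi.smul_apply, smul_eq_mul, ← Finset.mul_sum, h, mul_zero]

/-- The cyclic code of length `n` over `F` with defining set `T` relative to the `n`-th root of
unity `α`: all `c` such that `c(x) = ∑ i, c i * x ^ i` vanishes at `α ^ j` for every `j ∈ T`. -/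
def cyclicCode (α : AlgebraicClosure F) (T : Set (ZMod n)) : Submodule F (Fin n → F) where
  carrier := {c | ∀ j ∈ T,
    ∑ i, algebraMap F (AlgebraicClosure F) (c i) * (α ^ j.val) ^ (i : ℕ) = 0}
  add_mem' := by
    intro c c' hc hc' j hj
    simp only [Pi.add_apply, map_add, add_mul, Finset.sum_add_distrib, hc j hj, hc' j hj,
      add_zero]
  zero_mem' := by intro j _; simp
  smul_mem' := by
    intro s c hc j hj
    simp only [Pi.smul_apply, smul_eq_mul, map_mul, mul_assoc, ← Finset.mul_sum, hc j hj,
      mul_zero]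

/-- `{S₀, S₁, a}` is a splitting of `n` over a field with `q` elements: `S₀` and `S₁` are unions
of `q`-ary cyclotomic cosets modulo `n` which partition the nonzero residues, and multiplication
by the unit `a` interchanges them. -/
structure IsSplitting (q n : ℕ) (S₀ S₁ : Set (ZMod n)) (a : (ZMod n)ˣ) : Prop where
  closed₀ : ∀ j ∈ S₀, (q : ZMod n) * j ∈ S₀
  closed₁ : ∀ j ∈ S₁, (q : ZMod n) * j ∈ S₁
  disjoint : S₀ ∩ S₁ = ∅
  cover : S₀ ∪ S₁ = {j | j ≠ 0}
  swap₀ : (fun j => (a : ZMod n) * j) '' S₀ = S₁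
  swap₁ : (fun j => (a : ZMod n) * j) '' S₁ = S₀

/-- `D` is an odd-like duadic code of length `n` over `F` and `C` is its even-like subcode. -/
def IsDuadicPair [Fintype F] (C D : Submodule F (Fin n → F)) : Prop :=
  ∃ (α : AlgebraicClosure F) (S₀ S₁ : Set (ZMod n)) (a : (ZMod n)ˣ),
    IsPrimitiveRoot α n ∧ IsSplitting (Fintype.card F) n S₀ S₁ a ∧
    D = cyclicCode α S₀ ∧ C = evenLikeSubcode D

end Classical

/-! ### Quantum codes: subspaces of `ℂ^(q^n)` with orthonormal basis `|x⟩`, `x ∈ F^n` -/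

section Quantum

/-- The state space `ℂ^(q^n) = (ℂ^q)^{⊗ n}`. -/
abbrev StateSpace (F : Type*) (n : ℕ) : Type _ := EuclideanSpace ℂ (Fin n → F)

variable (p : ℕ) [Fact p.Prime] {F : Type*} [Field F] [Algebra (ZMod p) F] {n : ℕ}

/-- The additive character `x ↦ exp (2 π i tr(x) / p)` of `F`, with `tr : F → ZMod p`. -/
noncomputable def chi (x : F) : ℂ := ZMod.stdAddChar (Algebra.trace (ZMod p) F x)

theorem chi_zero : chi p (0 : F) = 1 := by simp [chi]

theorem chi_add (x y : F) : chi p (x + y) = chi p x * chi p y := by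
  simp [chi, AddChar.map_add_eq_mul]

theorem chi_cancel (x y : F) (h : x + y = 0) (c : ℂ) : chi p x * (chi p y * c) = c := by
  rw [← mul_assoc, ← chi_add, h, chi_zero, one_mul]

variable [Fintype F]

/-- The operator `X(a)`, with `X(a)|x⟩ = |x + a⟩`. -/
def opX (a : Fin n → F) : StateSpace F n ≃ₗ[ℂ] StateSpace F n where
  toFun ψ := WithLp.toLp 2 fun x => ψ (x - a)
  invFun ψ := WithLp.toLp 2 fun x => ψ (x + a)
  map_add' _ _ := by ext; simp
  map_smul' _ _ := by ext; simp
  left_inv _ := by ext; simp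
  right_inv _ := by ext; simp

/-- The operator `Z(b)`, with `Z(b)|x⟩ = exp (2 π i tr(b · x) / p) |x⟩`. -/
noncomputable def opZ (b : Fin n → F) : StateSpace F n ≃ₗ[ℂ] StateSpace F n where
  toFun ψ := WithLp.toLp 2 fun x => chi p (∑ i, b i * x i) * ψ x
  invFun ψ := WithLp.toLp 2 fun x => chi p (-∑ i, b i * x i) * ψ x
  map_add' _ _ := by ext; simp [mul_add]
  map_smul' _ _ := by ext; simp [mul_left_comm]
  left_inv _ := by ext; simp [chi_cancel]
  right_inv _ := by ext; simp [chi_cancel]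

/-- The error operator `X(a) Z(b)`. -/
noncomputable def errorOp (a b : Fin n → F) : StateSpace F n ≃ₗ[ℂ] StateSpace F n :=
  opX a * opZ p b

/-- The weight of `X(a) Z(b)`: the number of tensor factors on which it is not a scalar. -/
noncomputable def errorWeight (a b : Fin n → F) : ℕ := {i | a i ≠ 0 ∨ b i ≠ 0}.ncard

variable (F n) in
/-- The error group, generated by all `X(a) Z(b)`. -/
noncomputable def errorGroup : Subgroup (StateSpace F n ≃ₗ[ℂ] StateSpace F n) :=
  Subgroup.closure {E | ∃ a b : Fin n → F, E = errorOp p a b}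

/-- `Q` is the joint `+1`-eigenspace of an abelian subgroup of the error group. -/
def IsStabilizerCode (Q : Submodule ℂ (StateSpace F n)) : Prop :=
  ∃ S : Subgroup (StateSpace F n ≃ₗ[ℂ] StateSpace F n), S ≤ errorGroup p F n ∧
    (∀ E ∈ S, ∀ E' ∈ S, E * E' = E' * E) ∧ ∀ v, v ∈ Q ↔ ∀ E ∈ S, E v = v

/-- `⟨u|E|u⟩ = ⟨v|E|v⟩` for all unit vectors `u, v ∈ Q` and all errors of weight `< d`. -/
def DetectsBelow (Q : Submodule ℂ (StateSpace F n)) (d : ℕ) : Prop :=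
  ∀ a b : Fin n → F, errorWeight a b < d → ∀ u ∈ Q, ∀ v ∈ Q, ‖u‖ = 1 → ‖v‖ = 1 →
    inner ℂ u (errorOp p a b u) = inner ℂ v (errorOp p a b v)

/-- `Q` is an `[[n, k, d]]_q` stabilizer code with minimum distance exactly `d`. -/
structure IsCodeWithParams (Q : Submodule ℂ (StateSpace F n)) (k d : ℕ) : Prop where
  stabilizer : IsStabilizerCode p Q
  finrank_eq : Module.finrank ℂ Q = Fintype.card F ^ k
  distance : IsGreatest {t | DetectsBelow p Q t} d

/-- `Q` is pure to `t`: `⟨v|E|v⟩ = q^{-n} tr E` for all unit vectors `v ∈ Q` and all errors `E`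
of weight `< t`. -/
def PureTo (Q : Submodule ℂ (StateSpace F n)) (t : ℕ) : Prop :=
  ∀ a b : Fin n → F, errorWeight a b < t → ∀ v ∈ Q, ‖v‖ = 1 →
    inner ℂ v (errorOp p a b v) = ((Fintype.card F : ℂ) ^ n)⁻¹ *
      LinearMap.trace ℂ (StateSpace F n)
        (errorOp p a b : StateSpace F n →ₗ[ℂ] StateSpace F n)

/-- A code of minimum distance `d` is degenerate if it is not pure to `d`. -/
def IsDegenerate (Q : Submodule ℂ (StateSpace F n)) (d : ℕ) : Prop := ¬ PureTo p Q d

/-- The CSS code of `C ⊆ D ⊆ F^n`: the joint `+1`-eigenspace of all `X(c)` with `c ∈ C` and all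
`Z(b)` with `b ∈ D^⊥`. -/
def cssCode (C D : Submodule F (Fin n → F)) : Submodule ℂ (StateSpace F n) where
  carrier := {v | (∀ c ∈ C, opX c v = v) ∧ ∀ b ∈ dualCode D, opZ p b v = v}
  add_mem' := by
    rintro v w ⟨h₁, h₂⟩ ⟨h₁', h₂'⟩
    exact ⟨fun c hc => by rw [map_add, h₁ c hc, h₁' c hc],
      fun b hb => by rw [map_add, h₂ b hb, h₂' b hb]⟩
  zero_mem' := ⟨fun c _ => map_zero _, fun b _ => map_zero _⟩
  smul_mem' := by
    rintro s v ⟨h₁, h₂⟩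
    exact ⟨fun c hc => by rw [map_smul, h₁ c hc], fun b hb => by rw [map_smul, h₂ b hb]⟩

end Quantum

end DuadicQuantum

set_option linter.unusedSectionVars false

namespace DuadicQuantum

/-! ### CSS codes: structure, dimension, detection and purity -/

section Quantum

variable (p : ℕ) [Fact p.Prime] {F : Type*} [Field F] [Algebra (ZMod p) F] {n : ℕ}

/-! Detection for the CSS code of `C ⊆ D` is governed by two classical sets: `X(a)Z(b)` is detected
unless `a ∈ D \ C` or `b ∈ C^⊥ \ D^⊥` (`detectsBelow_cssCode`). For a duadic pair such words have
nonzero coordinate sum, and vanish on `S₀` or on `-S₁` respectively. Convolving such a word with a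
dilate of itself gives a word whose spectrum lives only at `0`, that is, a nonzero constant word. So
every residue modulo `n` is a combination of two support elements, and the weight `t` satisfies `n ≤
t ^ 2`. When the multiplier is `-1`, the diagonal pairs all give `0`, whence `n ≤ t ^ 2 - t + 1`
(`square_root_bounds`).

Purity fails early because the splitting is chosen for that purpose. Let `p₀` be the prime
minimising `p_i ^ z_i`. Residues prime to `p₀` are classified by the Legendre symbol modulo `p₀`,
the others by a symbol at some prime dividing `n` (`exists_isSplitting`). Since `q` is a square
modulo each prime, the classes are stable under `q`; a simultaneous nonresidue swaps them. All
residues that are nonsquares modulo `p₀` lie in `S₁`, so the idempotent with that spectrum lies in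
`C`. Its spectrum has period `p₀`, so its support lies in the subgroup killed by `p₀` and its weight
is at most `p₀` (`exists_low_weight_word`). The corresponding `X(c)` lies in the stabilizer, forcing
`d' ≤ p₀ ≤ p₀ ^ z`. On the other hand `d ^ 2 ≥ n ≥ p₀ ^ m > p₀ ^ (2z)`, so `d > p₀ ^ z` and the code
is degenerate. -/

theorem exists_chi_ne_one [Finite F] : ∃ x : F, chi p x ≠ 1 := by
  obtain ⟨x, hx⟩ := Algebra.trace_surjective (ZMod p) F 1
  refine ⟨x, fun h => ?_⟩
  rw [chi, hx, ← AddChar.map_zero_eq_one (ZMod.stdAddChar (N := p))] at h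
  exact one_ne_zero (ZMod.injective_stdAddChar h)

theorem exists_chi_mul_ne_one [Finite F] {y : F} (hy : y ≠ 0) : ∃ s : F, chi p (s * y) ≠ 1 := by
  obtain ⟨x, hx⟩ := exists_chi_ne_one p (F := F)
  exact ⟨x / y, by rwa [div_mul_cancel₀ x hy]⟩

/-- A linear functional killing `D` but not `x`, written in coordinates; this is `D^⊥⊥ ⊆ D`. -/
theorem exists_dualCode_of_notMem {D : Submodule F (Fin n → F)} {x : Fin n → F} (hx : x ∉ D) :
    ∃ b ∈ dualCode D, ∑ i, b i * x i ≠ 0 := by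
  obtain ⟨f, hf, hD⟩ := Submodule.exists_le_ker_of_notMem hx
  have key : ∀ y, ∑ i, f (Pi.single i 1) * y i = f y := fun y => by
    rw [f.pi_apply_eq_sum_univ y]
    refine Finset.sum_congr rfl fun i _ => ?_
    rw [smul_eq_mul, mul_comm]
    congr 3
    ext j
    simp [Pi.single_apply, eq_comm]
  exact ⟨fun i => f (Pi.single i 1), fun c hc => by rw [key]; exact hD hc, by rwa [key]⟩

variable [Fintype F]

@[simp] theorem opX_apply (a : Fin n → F) (v : StateSpace F n) (x : Fin n → F) :
    opX a v x = v (x - a) := rfl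

@[simp] theorem opZ_apply (b : Fin n → F) (v : StateSpace F n) (x : Fin n → F) :
    opZ p b v x = chi p (∑ i, b i * x i) * v x := rfl

@[simp] theorem errorOp_apply (a b : Fin n → F) (v : StateSpace F n) (x : Fin n → F) :
    errorOp p a b v x = chi p (∑ i, b i * (x - a) i) * v (x - a) := rfl

/-- If `x ∉ D`, some multiple of a dual word gives a phase different from `1` at `x`, so the
amplitude there must vanish. On `D` all these phases are trivial. -/
theorem mem_cssCode_iff {C D : Submodule F (Fin n → F)} {v : StateSpace F n} :
    v ∈ cssCode p C D ↔ (∀ c ∈ C, ∀ x, v (x - c) = v x) ∧ ∀ x, x ∉ D → v x = 0 := by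
  change ((∀ c ∈ C, opX c v = v) ∧ ∀ b ∈ dualCode D, opZ p b v = v) ↔ _
  refine and_congr ⟨fun h c hc x => ?_, fun h c hc => ?_⟩ ⟨fun h x hx => ?_, fun h b hb => ?_⟩
  · rw [← opX_apply, h c hc]
  · ext x
    exact h c hc x
  · obtain ⟨b, hb, hbx⟩ := exists_dualCode_of_notMem hx
    obtain ⟨s, hs⟩ := exists_chi_mul_ne_one p hbx
    have := congrArg (fun w : StateSpace F n => w x) (h (s • b) ((dualCode D).smul_mem s hb))
    simp only [opZ_apply, Pi.smul_apply, smul_eq_mul, mul_assoc, ← Finset.mul_sum] at this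
    by_contra hv
    exact hs (mul_right_cancel₀ hv (this.trans (one_mul _).symm))
  · ext x
    rw [opZ_apply]
    by_cases hx : x ∈ D
    · rw [hb x hx, chi_zero, one_mul]
    · rw [h x hx, mul_zero]

theorem isStabilizerCode_cssCode {C D : Submodule F (Fin n → F)} (hCD : C ≤ D) :
    IsStabilizerCode p (cssCode p C D) := by
  let G : Set (StateSpace F n ≃ₗ[ℂ] StateSpace F n) :=
    {E | (∃ c ∈ C, E = opX c) ∨ ∃ b ∈ dualCode D, E = opZ p b}
  have hXZ : ∀ c ∈ C, ∀ b ∈ dualCode D, opX c * opZ p b = opZ p b * opX c := by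
    intro c hc b hb
    ext v x
    simp only [LinearEquiv.mul_apply, opX_apply, opZ_apply, Pi.sub_apply, mul_sub,
      Finset.sum_sub_distrib, hb c (hCD hc), sub_zero]
  have hG : ∀ E ∈ G, ∀ E' ∈ G, E * E' = E' * E := by
    rintro E (⟨c, hc, rfl⟩ | ⟨b, hb, rfl⟩) E' (⟨c', hc', rfl⟩ | ⟨b', hb', rfl⟩)
    · ext v x
      simp only [LinearEquiv.mul_apply, opX_apply, sub_right_comm]
    · exact hXZ c hc b' hb'
    · exact (hXZ c' hc' b hb).symm
    · ext v x
      simp only [LinearEquiv.mul_apply, opZ_apply, mul_left_comm]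
  refine ⟨Subgroup.closure G, ?_, ?_, fun v => ⟨fun hv E hE => ?_, fun h => ⟨?_, ?_⟩⟩⟩
  · refine Subgroup.closure_mono ?_
    rintro E (⟨c, -, rfl⟩ | ⟨b, -, rfl⟩)
    · refine ⟨c, 0, ?_⟩
      ext v x
      simp [chi_zero]
    · refine ⟨0, b, ?_⟩
      ext v x
      simp
  · intro E hE E' hE'
    -- Commutation passes from generators to the closure in two stages: first `G` centralizes the
    -- closure, then the closure does.
    have h₁ : ∀ A ∈ G, A ∈ Subgroup.centralizer (Subgroup.closure G : Set _) := fun A hA => by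
      rw [Subgroup.centralizer_closure]
      exact Subgroup.mem_centralizer_iff.2 fun B hB => hG B hB A hA
    exact (Subgroup.mem_centralizer_iff.1 ((Subgroup.closure_le _).2 h₁ hE') E hE)
  · induction hE using Subgroup.closure_induction with
    | mem E hE =>
      rcases hE with ⟨c, hc, rfl⟩ | ⟨b, hb, rfl⟩
      · exact hv.1 c hc
      · exact hv.2 b hb
    | one => rfl
    | mul A B _ _ hA hB => rw [LinearEquiv.mul_apply, hB, hA]
    | inv A _ hA =>
      change A.symm v = v
      rw [LinearEquiv.symm_apply_eq, hA]
  · exact fun c hc => h _ (Subgroup.subset_closure (Or.inl ⟨c, hc, rfl⟩))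
  · exact fun b hb => h _ (Subgroup.subset_closure (Or.inr ⟨b, hb, rfl⟩))

open Classical in
/-- The state on `D` whose amplitude at `x ∈ D` is a given function of `∑ i, x i`. -/
noncomputable def sumState (D : Submodule F (Fin n → F)) : (F → ℂ) →ₗ[ℂ] StateSpace F n where
  toFun f := WithLp.toLp 2 fun x => if x ∈ D then f (∑ i, x i) else 0
  map_add' _ _ := by
    ext x
    by_cases hx : x ∈ D <;> simp [hx]
  map_smul' _ _ := by
    ext x
    by_cases hx : x ∈ D <;> simp [hx]

theorem sumState_apply_of_mem {D : Submodule F (Fin n → F)} {x : Fin n → F} (hx : x ∈ D)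
    (f : F → ℂ) : sumState D f x = f (∑ i, x i) := by
  simp [sumState, hx]

theorem sumState_apply_of_notMem {D : Submodule F (Fin n → F)} {x : Fin n → F} (hx : x ∉ D)
    (f : F → ℂ) : sumState D f x = 0 := by
  simp [sumState, hx]

theorem sum_const_div (hn : (n : F) ≠ 0) (s : F) : ∑ _i : Fin n, s / (n : F) = s := by
  rw [Finset.sum_const, Finset.card_univ, Fintype.card_fin, nsmul_eq_mul, mul_div_cancel₀ _ hn]

theorem const_mem {D : Submodule F (Fin n → F)} (h1 : (fun _ => 1) ∈ D) (s : F) :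
    (fun _ => s) ∈ D := by
  have := D.smul_mem s h1
  convert this using 1
  ext i
  simp

/-- As `n` is invertible in `F`, `D` is the even-like subcode plus the constant words, so its cosets
are labelled by the coordinate sum. Code states are exactly the functions of this label, which makes
the dimension `q`. -/
theorem range_sumState {D : Submodule F (Fin n → F)} (hn : (n : F) ≠ 0)
    (h1 : (fun _ => 1) ∈ D) :
    LinearMap.range (sumState D) = cssCode p (evenLikeSubcode D) D := by
  ext v
  rw [mem_cssCode_iff]
  constructor
  · rintro ⟨f, rfl⟩
    refine ⟨fun c hc x => ?_, fun x hx => sumState_apply_of_notMem hx f⟩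
    by_cases hx : x ∈ D
    · rw [sumState_apply_of_mem hx, sumState_apply_of_mem (D.sub_mem hx hc.1)]
      simp only [Pi.sub_apply, Finset.sum_sub_distrib, hc.2, sub_zero]
    · rw [sumState_apply_of_notMem hx, sumState_apply_of_notMem]
      exact fun h => hx ((D.sub_mem_iff_left hc.1).1 h)
  · rintro ⟨hC, hD⟩
    refine ⟨fun s => v fun _ => s / n, ?_⟩
    ext x
    by_cases hx : x ∈ D
    · rw [sumState_apply_of_mem hx]
      have hc : (x - fun _ => (∑ i, x i) / (n : F)) ∈ evenLikeSubcode D :=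
        ⟨D.sub_mem hx (const_mem h1 _), by
          simp only [Pi.sub_apply, Finset.sum_sub_distrib, sum_const_div hn, sub_self]⟩
      have := hC _ hc x
      rwa [sub_sub_cancel] at this
    · rw [sumState_apply_of_notMem hx, hD x hx]

theorem finrank_cssCode {D : Submodule F (Fin n → F)} (hn : (n : F) ≠ 0)
    (h1 : (fun _ => 1) ∈ D) :
    Module.finrank ℂ (cssCode p (evenLikeSubcode D) D) = Fintype.card F := by
  rw [← range_sumState p hn h1, LinearMap.finrank_range_of_inj, Module.finrank_fintype_fun_eq_card]
  intro f g hfg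
  ext s
  have := congrArg (fun w : StateSpace F n => w fun _ => s / n) hfg
  simpa only [sumState_apply_of_mem (const_mem h1 _), sum_const_div hn] using this

theorem card_support_le_errorWeight_left [DecidableEq F] (a b : Fin n → F) :
    (Finset.univ.filter fun i => a i ≠ 0).card ≤ errorWeight a b := by
  rw [errorWeight, ← Set.ncard_coe_finset]
  exact Set.ncard_le_ncard (fun i hi => Or.inl (by simpa using hi)) (Set.toFinite _)

theorem card_support_le_errorWeight_right [DecidableEq F] (a b : Fin n → F) :
    (Finset.univ.filter fun i => b i ≠ 0).card ≤ errorWeight a b := by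
  rw [errorWeight, ← Set.ncard_coe_finset]
  exact Set.ncard_le_ncard (fun i hi => Or.inr (by simpa using hi)) (Set.toFinite _)

theorem inner_self_of_norm {v : StateSpace F n} (hv : ‖v‖ = 1) : inner ℂ v v = 1 := by
  rw [inner_self_eq_norm_sq_to_K, hv]
  simp

/-- A CSS code detects every error outside the undetectable sets. -/
theorem detectsBelow_cssCode {C D : Submodule F (Fin n → F)} {w : ℕ}
    (hX : ∀ a b : Fin n → F, errorWeight a b < w → a ∈ D → a ∈ C)
    (hZ : ∀ a b : Fin n → F, errorWeight a b < w → b ∈ dualCode C → b ∈ dualCode D) :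
    DetectsBelow p (cssCode p C D) w := by
  intro a b hw
  suffices h : ∃ s : ℂ, ∀ u ∈ cssCode p C D, ‖u‖ = 1 → inner ℂ u (errorOp p a b u) = s by
    obtain ⟨s, hs⟩ := h
    intro u hu v hv hu1 hv1
    rw [hs u hu hu1, hs v hv hv1]
  by_cases haD : a ∈ D
  · have haC := hX a b hw haD
    by_cases hbC : b ∈ dualCode C
    · have hbD := hZ a b hw hbC
      refine ⟨1, fun u hu hu1 => ?_⟩
      rw [← inner_self_of_norm hu1]
      congr 1
      ext x
      obtain ⟨h₁, h₂⟩ := (mem_cssCode_iff p).1 hu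
      rw [errorOp_apply, h₁ a haC]
      by_cases hx : x ∈ D
      · rw [hbD _ (D.sub_mem hx haD), chi_zero, one_mul]
      · rw [h₂ x hx, mul_zero]
    · have : ∃ c ∈ C, ∑ i, b i * c i ≠ 0 := by
        by_contra! h
        exact hbC h
      obtain ⟨c, hc, hbc⟩ := this
      obtain ⟨s, hs⟩ := exists_chi_mul_ne_one p hbc
      refine ⟨0, fun u hu _ => ?_⟩
      obtain ⟨h₁, -⟩ := (mem_cssCode_iff p).1 hu
      have hsc := C.smul_mem s hc
      -- Translating the summation variable by `s • c` leaves `u` unchanged but multiplies the sum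
      -- by a phase different from `1`, so the sum is zero.
      have key : inner ℂ u (errorOp p a b u) =
          chi p (s * ∑ i, b i * c i) * inner ℂ u (errorOp p a b u) := by
        simp only [PiLp.inner_apply, Finset.mul_sum]
        rw [← Equiv.sum_comp (Equiv.addRight (s • c))]
        refine Finset.sum_congr rfl fun x _ => ?_
        have e₁ : u (x + s • c) = u x := by
          rw [← h₁ _ hsc (x + s • c), add_sub_cancel_right]
        have e₂ : u (x + s • c - a) = u (x - a) := by
          rw [← h₁ _ hsc (x + s • c - a), sub_right_comm, add_sub_cancel_right]
        have e₃ : ∑ i, b i * (x + s • c - a) i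
            = s * (∑ i, b i * c i) + ∑ i, b i * (x - a) i := by
          rw [Finset.mul_sum, ← Finset.sum_add_distrib]
          refine Finset.sum_congr rfl fun i _ => ?_
          simp only [Pi.add_apply, Pi.sub_apply, Pi.smul_apply, smul_eq_mul]
          ring
        simp only [Equiv.coe_addRight, errorOp_apply, e₁, e₂, e₃, chi_add, RCLike.inner_apply]
        rw [← Finset.mul_sum]
        ring
      by_contra h
      exact hs (mul_right_cancel₀ h ((one_mul _).trans key)).symm
  -- For `a ∉ D` the error moves the support from `D` into a disjoint coset.
  · refine ⟨0, fun u hu _ => ?_⟩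
    obtain ⟨-, h₂⟩ := (mem_cssCode_iff p).1 hu
    rw [PiLp.inner_apply]
    refine Finset.sum_eq_zero fun x _ => ?_
    rw [errorOp_apply]
    by_cases hx : x ∈ D
    · rw [h₂ (x - a) fun h => haD ((D.sub_mem_iff_right hx).1 h), mul_zero, inner_zero_right]
    · rw [h₂ x hx, inner_zero_left]

theorem norm_inv_norm_smul {w : StateSpace F n} (hw : w ≠ 0) :
    ‖((‖w‖ : ℂ)⁻¹ • w)‖ = 1 := by
  rw [norm_smul, norm_inv, Complex.norm_real, norm_norm, inv_mul_cancel₀ (norm_ne_zero_iff.2 hw)]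

theorem errorOp_zero_right (a : Fin n → F) (v : StateSpace F n) :
    errorOp p a 0 v = opX a v := by
  ext x
  simp [chi_zero]

theorem sumState_ne_zero {D : Submodule F (Fin n → F)} (hn : (n : F) ≠ 0)
    (h1 : (fun _ => 1) ∈ D) {f : F → ℂ} {s : F} (hf : f s ≠ 0) : sumState D f ≠ 0 := by
  intro h
  have := congrArg (fun w : StateSpace F n => w fun _ => s / n) h
  rw [sumState_apply_of_mem (const_mem h1 _), sum_const_div hn] at this
  exact hf this

/-- This makes the distance finite. `X(1,…,1)` shifts the coordinate-sum label by `n ≠ 0`: it fixes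
the uniform state on `D` and sends the state with label `0` to an orthogonal one. -/
theorem not_detectsBelow_cssCode {D : Submodule F (Fin n → F)} (hn : (n : F) ≠ 0)
    (h1 : (fun _ => 1) ∈ D) {t : ℕ} (ht : n < t) :
    ¬ DetectsBelow p (cssCode p (evenLikeSubcode D) D) t := by
  classical
  intro h
  have hr := range_sumState p hn h1
  have hmem : ∀ f, ∀ s : ℂ, s • sumState D f ∈ cssCode p (evenLikeSubcode D) D := fun f s => by
    rw [← hr]
    exact Submodule.smul_mem _ s ⟨f, rfl⟩
  have hu0 : sumState D (fun _ => 1) ≠ 0 := sumState_ne_zero hn h1 (s := 0) one_ne_zero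
  have hv0 : sumState D (Pi.single 0 1) ≠ 0 :=
    sumState_ne_zero hn h1 (s := 0) (by simp)
  have hwt : errorWeight (fun _ => 1 : Fin n → F) 0 < t := by
    refine lt_of_le_of_lt ?_ ht
    simp [errorWeight]
  have := h _ _ hwt _ (hmem (fun _ => 1) _) _ (hmem (Pi.single 0 1) _)
    (norm_inv_norm_smul hu0) (norm_inv_norm_smul hv0)
  rw [errorOp_zero_right, errorOp_zero_right] at this
  have e₁ : opX (fun _ => 1) (((‖sumState D (fun _ => 1)‖ : ℂ))⁻¹ • sumState D (fun _ => 1)) =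
      ((‖sumState D (fun _ => 1)‖ : ℂ))⁻¹ • sumState D (fun _ => 1) := by
    rw [map_smul]
    congr 1
    ext x
    rw [opX_apply]
    by_cases hx : x ∈ D
    · rw [sumState_apply_of_mem hx, sumState_apply_of_mem (D.sub_mem hx h1)]
    · rw [sumState_apply_of_notMem hx, sumState_apply_of_notMem]
      exact fun h => hx ((D.sub_mem_iff_left h1).1 h)
  rw [e₁, inner_self_of_norm (norm_inv_norm_smul hu0), map_smul, inner_smul_left,
    inner_smul_right] at this
  have e₂ : inner ℂ (sumState D (Pi.single 0 1)) (opX (fun _ => 1) (sumState D (Pi.single 0 1)))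
      = 0 := by
    rw [PiLp.inner_apply]
    refine Finset.sum_eq_zero fun x _ => ?_
    rw [opX_apply]
    by_cases hx : x ∈ D
    · rw [sumState_apply_of_mem hx, sumState_apply_of_mem (D.sub_mem hx h1)]
      simp only [Pi.sub_apply, Finset.sum_sub_distrib, Finset.sum_const, Finset.card_univ,
        Fintype.card_fin, nsmul_eq_mul, mul_one]
      by_cases hs : ∑ i, x i = 0
      · rw [hs, zero_sub, Pi.single_eq_of_ne (neg_ne_zero.2 hn), inner_zero_right]
      · rw [Pi.single_eq_of_ne hs, inner_zero_left]
    · rw [sumState_apply_of_notMem hx, inner_zero_left]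
  rw [e₂, mul_zero, mul_zero] at this
  exact one_ne_zero this

theorem trace_errorOp_zero_right {a : Fin n → F} (ha : a ≠ 0) :
    LinearMap.trace ℂ (StateSpace F n)
      (errorOp p a 0 : StateSpace F n →ₗ[ℂ] StateSpace F n) = 0 := by
  classical
  rw [LinearMap.trace_eq_matrix_trace ℂ (EuclideanSpace.basisFun (Fin n → F) ℂ).toBasis]
  refine Finset.sum_eq_zero fun x _ => ?_
  rw [Matrix.diag_apply, LinearMap.toMatrix_apply]
  have hx : x - a ≠ x := fun h => ha (by simpa using h)
  simp [chi_zero, hx]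

/-- `X(c)` acts trivially on the code, so its expectation is `1`, while its trace is `0`. -/
theorem le_errorWeight_of_pureTo {D : Submodule F (Fin n → F)} (hn : (n : F) ≠ 0)
    (h1 : (fun _ => 1) ∈ D) {c : Fin n → F} (hc : c ∈ evenLikeSubcode D) (hc0 : c ≠ 0) {t : ℕ}
    (ht : PureTo p (cssCode p (evenLikeSubcode D) D) t) : t ≤ errorWeight c 0 := by
  by_contra! hlt
  have hu0 : sumState D (fun _ => 1) ≠ 0 := sumState_ne_zero hn h1 (s := 0) one_ne_zero
  have hu : ((‖sumState D (fun _ => 1)‖ : ℂ))⁻¹ • sumState D (fun _ => 1) ∈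
      cssCode p (evenLikeSubcode D) D :=
    Submodule.smul_mem _ _ (by rw [← range_sumState p hn h1]; exact ⟨_, rfl⟩)
  have := ht c 0 hlt _ hu (norm_inv_norm_smul hu0)
  rw [trace_errorOp_zero_right p hc0, mul_zero, errorOp_zero_right, hu.1 c hc,
    inner_self_of_norm (norm_inv_norm_smul hu0)] at this
  exact one_ne_zero this

end Quantum


/-! ### Spectra of cyclic words and the square-root bound -/

section Fourier

variable {K : Type*} [Field K] {n : ℕ} [NeZero n] {α : K}

/-- The character `i ↦ α ^ i` of `ZMod n` attached to a primitive `n`-th root of unity. -/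
noncomputable def rootChar (hα : IsPrimitiveRoot α n) : AddChar (ZMod n) K :=
  AddChar.zmodChar n hα.pow_eq_one

/-- The Mattson–Solomon transform: the values of `∑ i, f i * x ^ i` at the powers of `α`. -/
noncomputable def spectrumAt (hα : IsPrimitiveRoot α n) (f : ZMod n → K) (j : ZMod n) : K :=
  ∑ i, f i * rootChar hα (i * j)

theorem rootChar_sum (hα : IsPrimitiveRoot α n) (b : ZMod n) :
    ∑ x, rootChar hα (x * b) = if b = 0 then (n : K) else 0 := by
  have := AddChar.sum_mulShift b (AddChar.zmodChar_primitive_of_primitive_root n hα)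
  rw [ZMod.card] at this
  rw [rootChar, this]
  split_ifs <;> simp

theorem spectrumAt_inversion (hα : IsPrimitiveRoot α n) (f : ZMod n → K) (k : ZMod n) :
    ∑ j, spectrumAt hα f j * rootChar hα (-(k * j)) = n * f k := by
  have : ∀ j, spectrumAt hα f j * rootChar hα (-(k * j)) =
      ∑ i, f i * rootChar hα (j * (i - k)) := fun j => by
    rw [spectrumAt, Finset.sum_mul]
    refine Finset.sum_congr rfl fun i _ => ?_
    rw [mul_assoc, ← AddChar.map_add_eq_mul]
    congr 2
    ring
  simp only [this]
  rw [Finset.sum_comm]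
  simp only [← Finset.mul_sum, rootChar_sum, sub_eq_zero]
  simp [mul_comm]

theorem spectrumAt_convolution (hα : IsPrimitiveRoot α n) (f g : ZMod n → K) (j : ZMod n) :
    spectrumAt hα (fun k => ∑ i, f i * g (k - i)) j = spectrumAt hα f j * spectrumAt hα g j := by
  simp only [spectrumAt, Finset.sum_mul]
  rw [Finset.sum_comm]
  refine Finset.sum_congr rfl fun i _ => ?_
  rw [Finset.mul_sum, ← Equiv.sum_comp (Equiv.addRight i)]
  refine Finset.sum_congr rfl fun k _ => ?_
  rw [Equiv.coe_addRight, add_sub_cancel_right, add_mul, AddChar.map_add_eq_mul]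
  ring

theorem spectrumAt_dilation (hα : IsPrimitiveRoot α n) (f : ZMod n → K) (u : (ZMod n)ˣ)
    (j : ZMod n) :
    spectrumAt hα (fun i => f (u * i)) j = spectrumAt hα f (↑u⁻¹ * j) := by
  symm
  rw [spectrumAt, ← Equiv.sum_comp (Units.mulLeft u), spectrumAt]
  refine Finset.sum_congr rfl fun i _ => ?_
  rw [Units.mulLeft_apply, mul_mul_mul_comm, Units.mul_inv, one_mul]

theorem spectrumAt_translation (hα : IsPrimitiveRoot α n) (f : ZMod n → K) (k j : ZMod n) :
    spectrumAt hα (fun i => f (i - k)) j = rootChar hα (k * j) * spectrumAt hα f j := by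
  rw [spectrumAt, spectrumAt, ← Equiv.sum_comp (Equiv.addRight k), Finset.mul_sum]
  refine Finset.sum_congr rfl fun i _ => ?_
  rw [Equiv.coe_addRight, add_sub_cancel_right, add_mul, AddChar.map_add_eq_mul]
  ring

/-- If the zeros `T` of `f` and their multiples by `u` cover all nonzero residues, but `0` is not
a zero, then the support of `f` represents every residue. -/
theorem exists_support_add (hα : IsPrimitiveRoot α n) {f : ZMod n → K}
    {T : Set (ZMod n)} (hT : ∀ j ∈ T, spectrumAt hα f j = 0) (h0 : spectrumAt hα f 0 ≠ 0)
    (u : (ZMod n)ˣ) (hu : ∀ j ≠ 0, j ∈ T ∨ ↑u⁻¹ * j ∈ T) (k : ZMod n) :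
    ∃ x y, f x ≠ 0 ∧ f y ≠ 0 ∧ k = x + ↑u⁻¹ * y := by
  -- The convolution of `f` with its dilate `g` has spectrum zero away from `0` and `(spectrumAt hα
  -- f 0) ^ 2` at `0`; by inversion it is nonzero at every `k`.
  set g : ZMod n → K := fun i => f (u * i)
  have hinv := spectrumAt_inversion hα (fun k => ∑ i, f i * g (k - i)) k
  simp only [spectrumAt_convolution] at hinv
  rw [Finset.sum_eq_single 0] at hinv
  · have hne : ∑ i, f i * g (k - i) ≠ 0 := by
      intro h
      rw [h, mul_zero, mul_zero, neg_zero, AddChar.map_zero_eq_one, mul_one,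
        spectrumAt_dilation, mul_zero] at hinv
      exact h0 (mul_self_eq_zero.1 hinv)
    obtain ⟨i, -, hi⟩ := Finset.exists_ne_zero_of_sum_ne_zero hne
    exact ⟨i, u * (k - i), left_ne_zero_of_mul hi, right_ne_zero_of_mul hi, by simp⟩
  · intro j _ hj
    rcases hu j hj with h | h
    · rw [hT j h, zero_mul, zero_mul]
    · rw [spectrumAt_dilation, hT _ h, mul_zero, zero_mul]
  · exact fun h => absurd (Finset.mem_univ _) h

theorem le_sq_card_support [DecidableEq K] (hα : IsPrimitiveRoot α n) {f : ZMod n → K}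
    {T : Set (ZMod n)} (hT : ∀ j ∈ T, spectrumAt hα f j = 0) (h0 : spectrumAt hα f 0 ≠ 0)
    (u : (ZMod n)ˣ) (hu : ∀ j ≠ 0, j ∈ T ∨ ↑u⁻¹ * j ∈ T) :
    n ≤ (Finset.univ.filter fun i => f i ≠ 0).card ^ 2 := by
  set s := Finset.univ.filter fun i => f i ≠ 0
  have : (Finset.univ : Finset (ZMod n)) ⊆
      (s ×ˢ s).image fun x => x.1 + ↑u⁻¹ * x.2 := by
    intro k _
    obtain ⟨x, y, hx, hy, rfl⟩ := exists_support_add hα hT h0 u hu k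
    exact Finset.mem_image.2 ⟨(x, y), by simp [s, hx, hy], rfl⟩
  calc n = (Finset.univ : Finset (ZMod n)).card := by rw [Finset.card_univ, ZMod.card]
    _ ≤ (s ×ˢ s).card := (Finset.card_le_card this).trans Finset.card_image_le
    _ = s.card ^ 2 := by rw [Finset.card_product, sq]

/-- With multiplier `-1` every residue is a difference of support elements. Diagonal pairs only give
`0`, so `t * (t - 1)` ordered pairs must cover the rest. -/
theorem add_card_support_le [DecidableEq K] (hα : IsPrimitiveRoot α n) {f : ZMod n → K}
    {T : Set (ZMod n)} (hT : ∀ j ∈ T, spectrumAt hα f j = 0) (h0 : spectrumAt hα f 0 ≠ 0)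
    (hu : ∀ j ≠ 0, j ∈ T ∨ -j ∈ T) :
    n + (Finset.univ.filter fun i => f i ≠ 0).card ≤
      (Finset.univ.filter fun i => f i ≠ 0).card ^ 2 + 1 := by
  set s := Finset.univ.filter fun i => f i ≠ 0
  have : (Finset.univ : Finset (ZMod n)) ⊆
      insert 0 (s.offDiag.image fun x => x.1 - x.2) := by
    intro k _
    obtain ⟨x, y, hx, hy, rfl⟩ := exists_support_add hα hT h0 (-1) (by simpa using hu) k
    by_cases hxy : x = y
    · simp [hxy]
    · exact Finset.mem_insert_of_mem
        (Finset.mem_image.2 ⟨(x, y), by simp [s, hx, hy, hxy], by simp [sub_eq_add_neg]⟩)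
  have hle : n ≤ s.card * s.card - s.card + 1 := by
    calc n = (Finset.univ : Finset (ZMod n)).card := by rw [Finset.card_univ, ZMod.card]
      _ ≤ s.offDiag.card + 1 := (Finset.card_le_card this).trans
          ((Finset.card_insert_le _ _).trans (Nat.add_le_add_right Finset.card_image_le 1))
      _ = _ := by rw [Finset.offDiag_card]
  have := Nat.le_mul_self s.card
  rw [sq]
  omega

end Fourier

/-! ### Descent of idempotents to the base field -/

section FiniteField

variable {F : Type*} [Field F] [Fintype F]

theorem mem_range_algebraMap_of_pow_card {K : Type*} [Field K] [Algebra F K] {x : K}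
    (hx : x ^ Fintype.card F = x) : ∃ y, algebraMap F K y = x := by
  classical
  have hq := Fintype.one_lt_card (α := F)
  have hne : (Polynomial.X ^ Fintype.card F - Polynomial.X : Polynomial K) ≠ 0 :=
    FiniteField.X_pow_card_sub_X_ne_zero K hq
  have hsub : Finset.univ.image (algebraMap F K) ⊆
      (Polynomial.X ^ Fintype.card F - Polynomial.X : Polynomial K).roots.toFinset := by
    intro y hy
    obtain ⟨z, -, rfl⟩ := Finset.mem_image.1 hy
    rw [Multiset.mem_toFinset, Polynomial.mem_roots hne]
    simp [← map_pow, FiniteField.pow_card]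
  have heq := Finset.eq_of_subset_of_card_le hsub (by
    rw [Finset.card_image_of_injective _ (algebraMap F K).injective, Finset.card_univ]
    refine (Multiset.toFinset_card_le _).trans ((Polynomial.card_roots' _).trans ?_)
    rw [FiniteField.X_pow_card_sub_X_natDegree_eq K hq])
  have : x ∈ Finset.univ.image (algebraMap F K) := by
    rw [heq, Multiset.mem_toFinset, Polynomial.mem_roots hne]
    simp [hx]
  obtain ⟨y, -, hy⟩ := Finset.mem_image.1 this
  exact ⟨y, hy⟩

variable {K : Type*} [Field K] [Algebra F K] {n : ℕ} [NeZero n] {α : K}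

/-- The idempotent whose spectrum is the indicator function of a union of cyclotomic cosets. -/
theorem exists_idempotent (hα : IsPrimitiveRoot α n) (hcop : (Fintype.card F).Coprime n)
    (hn : (n : K) ≠ 0) (T : Finset (ZMod n))
    (hT : ∀ j ∈ T, (Fintype.card F : ZMod n) * j ∈ T) :
    ∃ c : ZMod n → F,
      (∀ i, algebraMap F K (c i) = (n : K)⁻¹ * ∑ k ∈ T, rootChar hα (-(k * i))) ∧
      ∀ j, spectrumAt hα (fun i => algebraMap F K (c i)) j = if j ∈ T then 1 else 0 := by
  have key : ∀ i, ∃ y : F, algebraMap F K y = (n : K)⁻¹ * ∑ k ∈ T, rootChar hα (-(k * i)) := by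
    intro i
    refine mem_range_algebraMap_of_pow_card ?_
    -- The `q`-power Frobenius permutes the terms of the sum, because `T` is stable under
    -- multiplication by `q`; the value therefore lies in `F`.
    have hfrob : ∀ y : K, FiniteField.frobeniusAlgHom F K y = y ^ Fintype.card F :=
      fun y => congrFun (FiniteField.coe_frobeniusAlgHom F K) y
    rw [← hfrob, map_mul, map_inv₀, map_natCast, map_sum]
    congr 1
    simp only [hfrob, ← AddChar.map_nsmul_eq_pow]
    have hinj : Function.Injective fun j : ZMod n => (Fintype.card F : ZMod n) * j := by
      rw [← ZMod.coe_unitOfCoprime _ hcop]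
      exact (Units.mulLeft (ZMod.unitOfCoprime _ hcop)).injective
    have himg : T.image (fun j => (Fintype.card F : ZMod n) * j) = T :=
      Finset.eq_of_subset_of_card_le (Finset.image_subset_iff.2 hT)
        (by rw [Finset.card_image_of_injective _ hinj])
    conv_rhs => rw [← himg, Finset.sum_image hinj.injOn]
    refine Finset.sum_congr rfl fun k _ => ?_
    rw [nsmul_eq_mul, mul_neg, mul_assoc]
  choose c hc using key
  refine ⟨c, hc, fun j => ?_⟩
  have : ∀ i, algebraMap F K (c i) * rootChar hα (i * j) =
      (n : K)⁻¹ * ∑ k ∈ T, rootChar hα (i * (j - k)) := fun i => by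
    rw [hc, mul_assoc, Finset.sum_mul]
    congr 1
    refine Finset.sum_congr rfl fun k _ => ?_
    rw [← AddChar.map_add_eq_mul]
    congr 1
    ring
  simp only [spectrumAt, this, ← Finset.mul_sum]
  rw [Finset.sum_comm]
  simp only [rootChar_sum, sub_eq_zero, Finset.sum_ite_eq]
  split_ifs <;> simp [hn]

end FiniteField

/-! ### A splitting from quadratic residues -/

section Splitting

theorem isSquare_mul_iff {ℓ : ℕ} [Fact ℓ.Prime] {x y : ZMod ℓ} (hx : x ≠ 0) (hy : y ≠ 0) :
    IsSquare (x * y) ↔ (IsSquare x ↔ IsSquare y) := by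
  rw [← quadraticChar_one_iff_isSquare hx, ← quadraticChar_one_iff_isSquare hy,
    ← quadraticChar_one_iff_isSquare (mul_ne_zero hx hy), map_mul]
  rcases quadraticChar_dichotomy hx with h | h <;> rcases quadraticChar_dichotomy hy with h' | h' <;>
    rw [h, h'] <;> decide

/-- A prime `ℓ ∣ n` and an integer prime to `ℓ` attached to a nonzero residue modulo `n`. -/
def primePart (p₀ n v : ℕ) : ℕ × ℕ :=
  if p₀ ∣ v then ((n / n.gcd v).minFac, v / n.gcd v) else (p₀, v)

/-- A quadratic-residue symbol on the nonzero residues modulo `n`. -/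
def IsResidue (p₀ n : ℕ) (j : ZMod n) : Prop :=
  IsSquare ((primePart p₀ n j.val).2 : ZMod (primePart p₀ n j.val).1)

variable {p₀ n : ℕ}

theorem primePart_spec (hp₀ : p₀.Prime) (hdvd : p₀ ∣ n) {v : ℕ} (h0 : 0 < v) (hv : v < n) :
    (primePart p₀ n v).1.Prime ∧ (primePart p₀ n v).1 ∣ n ∧
      ¬ (primePart p₀ n v).1 ∣ (primePart p₀ n v).2 := by
  unfold primePart
  split_ifs with h
  · have hg : 0 < n.gcd v := Nat.gcd_pos_of_pos_right _ h0
    have hne : n / n.gcd v ≠ 1 := by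
      intro h1
      have := Nat.eq_of_dvd_of_div_eq_one (Nat.gcd_dvd_left n v) h1
      exact absurd (Nat.le_of_dvd h0 (this ▸ Nat.gcd_dvd_right n v)) (by omega)
    have hpr := Nat.minFac_prime hne
    refine ⟨hpr, (Nat.minFac_dvd _).trans (Nat.div_dvd_of_dvd (Nat.gcd_dvd_left n v)), fun hd => ?_⟩
    exact Nat.not_coprime_of_dvd_of_dvd hpr.one_lt (Nat.minFac_dvd _) hd
      (Nat.coprime_div_gcd_div_gcd hg)
  · exact ⟨hp₀, hdvd, h⟩

/-- Multiplying by a unit modulo `n` preserves the gcd with `n`, hence the chosen prime; the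
cofactor is multiplied by `w` modulo that prime. -/
theorem primePart_mul (hp₀ : p₀.Prime) (hdvd : p₀ ∣ n) {w v : ℕ} (hw : w.Coprime n) (h0 : 0 < v) :
    (primePart p₀ n (w * v % n)).1 = (primePart p₀ n v).1 ∧
      ((primePart p₀ n (w * v % n)).2 : ZMod (primePart p₀ n v).1) =
        w * (primePart p₀ n v).2 := by
  have hiff : p₀ ∣ w * v % n ↔ p₀ ∣ v := by
    rw [Nat.dvd_mod_iff hdvd, hp₀.dvd_mul, or_iff_right]
    exact fun h => Nat.not_coprime_of_dvd_of_dvd hp₀.one_lt h hdvd hw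
  have hgcd : n.gcd (w * v % n) = n.gcd v := by
    rw [Nat.gcd_comm, ← Nat.gcd_rec, Nat.Coprime.gcd_mul_left_cancel_right v hw]
  by_cases h : p₀ ∣ v
  · have hv : primePart p₀ n v = ((n / n.gcd v).minFac, v / n.gcd v) := if_pos h
    have hwv : primePart p₀ n (w * v % n) = ((n / n.gcd v).minFac, w * v % n / n.gcd v) := by
      rw [← hgcd]
      exact if_pos (hiff.2 h)
    rw [hv, hwv]
    refine ⟨rfl, ?_⟩
    set g := n.gcd v
    have hg : 0 < g := Nat.gcd_pos_of_pos_right _ h0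
    obtain ⟨m, hm⟩ := Nat.gcd_dvd_left n v
    obtain ⟨r, hr⟩ := Nat.gcd_dvd_right n v
    change n = g * m at hm
    change v = g * r at hr
    have e₁ : n / g = m := by rw [hm, Nat.mul_div_cancel_left _ hg]
    have e₂ : v / g = r := by rw [hr, Nat.mul_div_cancel_left _ hg]
    have e₃ : w * v % n / g = w * r % m := by
      rw [hm, hr, mul_left_comm, Nat.mul_mod_mul_left, Nat.mul_div_cancel_left _ hg]
    rw [e₁, e₂, e₃]
    change ((w * r % m : ℕ) : ZMod m.minFac) = w * (r : ZMod m.minFac)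
    rw [← Nat.cast_mul, ZMod.natCast_eq_natCast_iff]
    exact (Nat.mod_modEq _ _).of_dvd (Nat.minFac_dvd m)
  · have hv : primePart p₀ n v = (p₀, v) := if_neg h
    have hwv : primePart p₀ n (w * v % n) = (p₀, w * v % n) := if_neg (hiff.not.2 h)
    rw [hv, hwv]
    refine ⟨rfl, ?_⟩
    change ((w * v % n : ℕ) : ZMod p₀) = w * (v : ZMod p₀)
    rw [← Nat.cast_mul, ZMod.natCast_eq_natCast_iff]
    exact (Nat.mod_modEq _ _).of_dvd hdvd

variable [NeZero n]

theorem isResidue_mul (hp₀ : p₀.Prime) (hdvd : p₀ ∣ n) {w : ℕ} (hw : w.Coprime n) {j : ZMod n}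
    (hj : j ≠ 0) : ∃ ℓ : ℕ, ℓ.Prime ∧ ℓ ∣ n ∧
      (IsResidue p₀ n (w * j) ↔ (IsSquare (w : ZMod ℓ) ↔ IsResidue p₀ n j)) := by
  have h0 : 0 < j.val := Nat.pos_of_ne_zero ((ZMod.val_ne_zero j).2 hj)
  obtain ⟨hpr, hd, hnd⟩ := primePart_spec hp₀ hdvd h0 j.val_lt
  have hval : ((w : ZMod n) * j).val = w * j.val % n := by
    rw [ZMod.val_mul, ZMod.val_natCast, Nat.mod_mul_mod]
  obtain ⟨e₁, e₂⟩ := primePart_mul hp₀ hdvd hw h0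
  refine ⟨_, hpr, hd, ?_⟩
  have := Fact.mk hpr
  unfold IsResidue
  rw [hval, e₁, e₂, isSquare_mul_iff]
  · rw [Ne, ZMod.natCast_eq_zero_iff]
    exact fun h => Nat.not_coprime_of_dvd_of_dvd hpr.one_lt h hd hw
  · rwa [Ne, ZMod.natCast_eq_zero_iff]

theorem exists_isSplitting (hp₀ : p₀.Prime) (hdvd : p₀ ∣ n) {q w : ℕ} (hq : q.Coprime n)
    (hw : w.Coprime n) (hsq : ∀ ℓ : ℕ, ℓ.Prime → ℓ ∣ n → IsSquare (q : ZMod ℓ))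
    (hns : ∀ ℓ : ℕ, ℓ.Prime → ℓ ∣ n → ¬ IsSquare (w : ZMod ℓ)) :
    ∃ S₀ S₁ : Set (ZMod n), IsSplitting q n S₀ S₁ (ZMod.unitOfCoprime w hw) ∧
      ∀ j : ZMod n, ¬ IsSquare (ZMod.castHom hdvd (ZMod p₀) j) → j ∈ S₁ := by
  have hq' : ∀ j : ZMod n, j ≠ 0 → (q * j ≠ 0 ∧ (IsResidue p₀ n (q * j) ↔ IsResidue p₀ n j)) := by
    intro j hj
    obtain ⟨ℓ, h₁, h₂, h₃⟩ := isResidue_mul hp₀ hdvd hq hj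
    rw [← ZMod.coe_unitOfCoprime q hq] at h₃ ⊢
    refine ⟨(Units.mul_right_eq_zero _).not.2 hj, h₃.trans ?_⟩
    simp [hsq ℓ h₁ h₂]
  have hw' : ∀ j : ZMod n, j ≠ 0 → ((ZMod.unitOfCoprime w hw : ZMod n) * j ≠ 0 ∧
      (IsResidue p₀ n ((ZMod.unitOfCoprime w hw : ZMod n) * j) ↔ ¬ IsResidue p₀ n j)) := by
    intro j hj
    obtain ⟨ℓ, h₁, h₂, h₃⟩ := isResidue_mul hp₀ hdvd hw hj
    rw [← ZMod.coe_unitOfCoprime w hw] at h₃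
    refine ⟨(Units.mul_right_eq_zero _).not.2 hj, h₃.trans ?_⟩
    simp [hns ℓ h₁ h₂]
  set a := ZMod.unitOfCoprime w hw
  have hinv : ∀ j : ZMod n, j ≠ 0 → (↑a⁻¹ * j ≠ 0 ∧
      (IsResidue p₀ n (↑a⁻¹ * j) ↔ ¬ IsResidue p₀ n j)) := by
    intro j hj
    have h0 : ↑a⁻¹ * j ≠ 0 := (Units.mul_right_eq_zero _).not.2 hj
    have := (hw' _ h0).2
    rw [Units.mul_inv_cancel_left] at this
    exact ⟨h0, by tauto⟩
  refine ⟨{j | j ≠ 0 ∧ IsResidue p₀ n j}, {j | j ≠ 0 ∧ ¬ IsResidue p₀ n j},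
    ⟨fun j hj => ⟨(hq' j hj.1).1, (hq' j hj.1).2.2 hj.2⟩,
      fun j hj => ⟨(hq' j hj.1).1, fun h => hj.2 ((hq' j hj.1).2.1 h)⟩, ?_, ?_, ?_, ?_⟩, ?_⟩
  · ext j
    simp only [Set.mem_inter_iff, Set.mem_ofPred_eq, Set.mem_empty_iff_false]
    tauto
  · ext j
    simp only [Set.mem_union, Set.mem_ofPred_eq]
    tauto
  · ext j
    constructor
    · rintro ⟨k, hk, rfl⟩
      exact ⟨(hw' k hk.1).1, fun h => (hw' k hk.1).2.1 h hk.2⟩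
    · intro hj
      exact ⟨↑a⁻¹ * j, ⟨(hinv j hj.1).1, (hinv j hj.1).2.2 hj.2⟩, Units.mul_inv_cancel_left _ _⟩
  · ext j
    constructor
    · rintro ⟨k, hk, rfl⟩
      exact ⟨(hw' k hk.1).1, (hw' k hk.1).2.2 hk.2⟩
    · intro hj
      exact ⟨↑a⁻¹ * j, ⟨(hinv j hj.1).1, fun h => (hinv j hj.1).2.1 h hj.2⟩,
        Units.mul_inv_cancel_left _ _⟩
  -- A nonsquare modulo `p₀` is nonzero there, so the symbol of `j` is the plain one modulo `p₀`.
  · intro j hj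
    have hj0 : ¬ p₀ ∣ j.val := by
      intro h
      apply hj
      rw [ZMod.castHom_apply, ← ZMod.natCast_val, (ZMod.natCast_eq_zero_iff _ _).2 h]
      exact IsSquare.zero
    refine ⟨?_, ?_⟩
    · rintro rfl
      simp at hj0
    · unfold IsResidue primePart
      rw [if_neg hj0]
      rwa [ZMod.castHom_apply, ← ZMod.natCast_val] at hj

end Splitting

/-- Simultaneous nonresidues exist, and `-1` is one if all primes are `3` modulo `4`. -/
theorem exists_nonresidue {ι : Type*} [Fintype ι] {P : ι → ℕ} (hP : ∀ i, (P i).Prime)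
    (hPinj : Function.Injective P) (hodd : ∀ i, P i ≠ 2) {n : ℕ} (hn : 0 < n)
    (hdvd : ∀ i, P i ∣ n) :
    ∃ w : ℕ, (∀ i, ¬ IsSquare (w : ZMod (P i))) ∧
      ((∀ i, (P i : ℤ) ≡ -1 [ZMOD 4]) → (w : ZMod n) = -1) := by
  by_cases h : ∀ i, (P i : ℤ) ≡ -1 [ZMOD 4]
  -- `n - 1` represents `-1`, which is a nonsquare modulo every prime congruent to `3` modulo `4`.
  · refine ⟨n - 1, fun i => ?_, fun _ => ?_⟩
    · have := Fact.mk (hP i)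
      rw [Nat.cast_sub hn, (ZMod.natCast_eq_zero_iff _ _).2 (hdvd i), Nat.cast_one, zero_sub,
        ZMod.exists_sq_eq_neg_one_iff]
      have := h i
      rw [Int.ModEq] at this
      omega
    · rw [Nat.cast_sub hn, ZMod.natCast_self, Nat.cast_one, zero_sub]
  · have key : ∀ i, ∃ r : ℕ, ¬ IsSquare (r : ZMod (P i)) := fun i => by
      have := Fact.mk (hP i)
      obtain ⟨a, ha⟩ := FiniteField.exists_nonsquare (F := ZMod (P i))
        (by rw [ZMod.ringChar_zmod_n]; exact hodd i)
      exact ⟨a.val, by rwa [ZMod.natCast_val, ZMod.cast_id]⟩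
    choose r hr using key
    obtain ⟨w, hw⟩ := Nat.chineseRemainderOfFinset r P Finset.univ (fun i _ => (hP i).ne_zero)
      (fun i _ j _ hij => (Nat.coprime_primes (hP i) (hP j)).2 (hPinj.ne hij))
    refine ⟨w, fun i => ?_, fun h' => absurd h' h⟩
    rw [(ZMod.natCast_eq_natCast_iff _ _ _).2 (hw i (Finset.mem_univ i))]
    exact hr i


/-! ### Duadic codes: dual words, light words, odd-like weights -/

section Duadic

variable {F : Type*} [Field F] {n : ℕ} [NeZero n] {α : AlgebraicClosure F}

/-- A word over `F`, indexed by residues modulo `n` and with entries in the algebraic closure. -/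
noncomputable def wordLift (c : Fin n → F) (i : ZMod n) : AlgebraicClosure F :=
  algebraMap F (AlgebraicClosure F) (c ((ZMod.finEquiv n).symm i))

theorem natCast_fin_eq_finEquiv (i : Fin n) : ((i : ℕ) : ZMod n) = ZMod.finEquiv n i := by
  cases n with
  | zero => exact i.elim0
  | succ k => exact Fin.cast_val_eq_self i

theorem rootChar_natCast_mul (hα : IsPrimitiveRoot α n) (i : ℕ) (j : ZMod n) :
    rootChar hα (i * j) = (α ^ j.val) ^ i := by
  rw [← nsmul_eq_mul, AddChar.map_nsmul_eq_pow, rootChar, AddChar.zmodChar_apply]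

theorem spectrumAt_wordLift (hα : IsPrimitiveRoot α n) (c : Fin n → F) (j : ZMod n) :
    spectrumAt hα (wordLift c) j =
      ∑ i, algebraMap F (AlgebraicClosure F) (c i) * (α ^ j.val) ^ (i : ℕ) := by
  rw [spectrumAt, ← Equiv.sum_comp (ZMod.finEquiv n).toEquiv]
  refine Finset.sum_congr rfl fun i _ => ?_
  rw [RingEquiv.toEquiv_eq_coe, RingEquiv.coe_toEquiv, ← rootChar_natCast_mul hα,
    natCast_fin_eq_finEquiv, wordLift, RingEquiv.symm_apply_apply]

theorem mem_cyclicCode_iff (hα : IsPrimitiveRoot α n) {T : Set (ZMod n)} {c : Fin n → F} :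
    c ∈ cyclicCode α T ↔ ∀ j ∈ T, spectrumAt hα (wordLift c) j = 0 := by
  simp only [spectrumAt_wordLift]
  rfl

theorem spectrumAt_wordLift_zero (hα : IsPrimitiveRoot α n) (c : Fin n → F) :
    spectrumAt hα (wordLift c) 0 = algebraMap F (AlgebraicClosure F) (∑ i, c i) := by
  simp [spectrumAt_wordLift]

theorem spectrumAt_wordLift_zero_eq_zero_iff (hα : IsPrimitiveRoot α n) (c : Fin n → F) :
    spectrumAt hα (wordLift c) 0 = 0 ↔ ∑ i, c i = 0 := by
  rw [spectrumAt_wordLift_zero, map_eq_zero]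

theorem card_support_wordLift [DecidableEq F] [DecidableEq (AlgebraicClosure F)]
    (c : Fin n → F) : (Finset.univ.filter fun i => wordLift c i ≠ 0).card =
      (Finset.univ.filter fun i => c i ≠ 0).card := by
  refine (Finset.card_equiv (ZMod.finEquiv n).toEquiv fun i => ?_).symm
  simp [wordLift]

theorem const_one_mem_cyclicCode (hα : IsPrimitiveRoot α n) {T : Set (ZMod n)}
    (hT : (0 : ZMod n) ∉ T) :
    (fun _ => 1) ∈ cyclicCode α T (F := F) := by
  rw [mem_cyclicCode_iff hα]
  intro j hj
  have := rootChar_sum hα j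
  rw [if_neg (by rintro rfl; exact hT hj)] at this
  simpa [spectrumAt, wordLift] using this

theorem exists_idempotent_word [Fintype F] (hα : IsPrimitiveRoot α n)
    (hcop : (Fintype.card F).Coprime n) (hn : (n : F) ≠ 0) (T : Set (ZMod n))
    [DecidablePred (· ∈ T)] (hT : ∀ j ∈ T, (Fintype.card F : ZMod n) * j ∈ T) :
    ∃ c : Fin n → F,
      (∀ i, wordLift c i = (n : AlgebraicClosure F)⁻¹ *
        ∑ k with k ∈ T, rootChar hα (-(k * i))) ∧
      ∀ j, spectrumAt hα (wordLift c) j = if j ∈ T then 1 else 0 := by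
  have hn' : (n : AlgebraicClosure F) ≠ 0 := by
    rw [← map_natCast (algebraMap F (AlgebraicClosure F))]
    exact (map_ne_zero _).2 hn
  obtain ⟨c, h₁, h₂⟩ := exists_idempotent (F := F) hα hcop hn' (Finset.univ.filter (· ∈ T))
    (by simpa using hT)
  have hlift : wordLift (fun i => c (ZMod.finEquiv n i)) = fun i => algebraMap F _ (c i) := by
    ext i
    simp [wordLift]
  refine ⟨fun i => c (ZMod.finEquiv n i), fun i => ?_, fun j => ?_⟩
  · exact (congrFun hlift i).trans (h₁ i)
  · rw [hlift, h₂]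
    simp

/-- The words orthogonal to an even-like cyclic code with nonzeros `S₁` vanish on `-S₁`. -/
theorem spectrumAt_neg_of_mem_dualCode [Fintype F] (hα : IsPrimitiveRoot α n)
    (hcop : (Fintype.card F).Coprime n) (hn : (n : F) ≠ 0) {S₀ S₁ : Set (ZMod n)}
    (hS₁ : ∀ j ∈ S₁, (Fintype.card F : ZMod n) * j ∈ S₁) (hdisj : S₀ ∩ S₁ = ∅)
    (h0 : (0 : ZMod n) ∉ S₁) {b : Fin n → F}
    (hb : b ∈ dualCode (evenLikeSubcode (cyclicCode α S₀))) {j : ZMod n} (hj : j ∈ S₁) :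
    spectrumAt hα (wordLift b) (-j) = 0 := by
  classical
  obtain ⟨c, -, hc⟩ := exists_idempotent_word hα hcop hn S₁ hS₁
  -- Every cyclic shift of the idempotent `c` lies in the even-like code, so `b` is orthogonal to
  -- all of them: its convolution with the reversal of `c` vanishes. That reversal has spectrum `1`
  -- at `-j`.
  have hconv : ∀ k, ∑ i, wordLift b i * wordLift c (-(k - i)) = 0 := by
    intro k
    set c' : Fin n → F := fun i => c ((ZMod.finEquiv n).symm (ZMod.finEquiv n i - k))
    have hlift : wordLift c' = fun i => wordLift c (i - k) := by
      ext i
      simp [wordLift, c']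
    have hc' : c' ∈ evenLikeSubcode (cyclicCode α S₀) := by
      constructor
      · rw [mem_cyclicCode_iff hα]
        intro l hl
        rw [hlift, spectrumAt_translation, hc, if_neg, mul_zero]
        exact fun h => Set.notMem_empty l (hdisj ▸ ⟨hl, h⟩)
      · rw [← spectrumAt_wordLift_zero_eq_zero_iff hα, hlift, spectrumAt_translation, hc,
          if_neg h0, mul_zero]
    have := congrArg (algebraMap F (AlgebraicClosure F)) (hb c' hc')
    rw [map_sum, map_zero] at this
    rw [← Equiv.sum_comp (ZMod.finEquiv n).toEquiv, ← this]
    refine Finset.sum_congr rfl fun i _ => ?_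
    simp [wordLift, c']
  have := spectrumAt_convolution hα (wordLift b) (fun i => wordLift c (-i)) (-j)
  have hneg := spectrumAt_dilation hα (wordLift c) (-1) (-j)
  simp only [Units.val_neg, Units.val_one, neg_mul, one_mul, inv_neg, inv_one, neg_neg] at hneg
  rw [hneg, hc, if_pos hj, mul_one] at this
  rw [← this]
  exact Finset.sum_eq_zero fun k _ => mul_eq_zero_of_left (hconv k) _

/-- A word orthogonal to the even-like subcode and to the constants would be orthogonal to all of
`D`. -/
theorem sum_ne_zero_of_mem_dualCode [Fintype F] {D : Submodule F (Fin n → F)} (hn : (n : F) ≠ 0)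
    (h1 : (fun _ => 1) ∈ D) {b : Fin n → F} (hb : b ∈ dualCode (evenLikeSubcode D))
    (hbD : b ∉ dualCode D) : ∑ i, b i ≠ 0 := by
  intro h
  refine hbD fun x hx => ?_
  set s := (∑ i, x i) / (n : F)
  have hc : (x - fun _ => s) ∈ evenLikeSubcode D := by
    refine ⟨D.sub_mem hx (const_mem h1 s), ?_⟩
    simp only [Pi.sub_apply, Finset.sum_sub_distrib, Finset.sum_const, Finset.card_univ,
      Fintype.card_fin, nsmul_eq_mul, s, mul_div_cancel₀ _ hn, sub_self]
  have := hb _ hc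
  simpa only [Pi.sub_apply, mul_sub, Finset.sum_sub_distrib, ← Finset.sum_mul, h, zero_mul,
    sub_zero] using this

/-- A word of weight at most `ℓ` in the even-like code, when `S₁` contains the residues reducing
to nonsquares modulo `ℓ`. -/
theorem exists_low_weight_word [Fintype F] (hα : IsPrimitiveRoot α n)
    (hcop : (Fintype.card F).Coprime n) (hn : (n : F) ≠ 0) {ℓ : ℕ} (hℓ : ℓ.Prime) (hdvd : ℓ ∣ n)
    (hsq : IsSquare (Fintype.card F : ZMod ℓ)) {S₀ S₁ : Set (ZMod n)} (hdisj : S₀ ∩ S₁ = ∅)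
    (hns : ∃ j : ZMod n, ¬ IsSquare (ZMod.castHom hdvd (ZMod ℓ) j))
    (hS₁ : ∀ j : ZMod n, ¬ IsSquare (ZMod.castHom hdvd (ZMod ℓ) j) → j ∈ S₁) :
    ∃ c ∈ evenLikeSubcode (cyclicCode α S₀) (F := F), c ≠ 0 ∧ errorWeight c 0 ≤ ℓ := by
  classical
  have := Fact.mk hℓ
  set φ := ZMod.castHom hdvd (ZMod ℓ)
  have hq0 : (Fintype.card F : ZMod ℓ) ≠ 0 := by
    rw [Ne, ZMod.natCast_eq_zero_iff]
    exact fun h => Nat.not_coprime_of_dvd_of_dvd hℓ.one_lt h hdvd hcop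
  obtain ⟨c, hc, hspec⟩ := exists_idempotent_word hα hcop hn {j | ¬ IsSquare (φ j)} (by
    intro j hj h
    rw [map_mul, map_natCast] at h
    by_cases hj0 : φ j = 0
    · exact hj (hj0 ▸ IsSquare.zero)
    · exact hj (((isSquare_mul_iff hq0 hj0).1 h).1 hsq))
  refine ⟨c, ⟨?_, ?_⟩, ?_, ?_⟩
  · rw [mem_cyclicCode_iff hα]
    intro j hj
    rw [hspec, if_neg]
    exact fun h => Set.notMem_empty j (hdisj ▸ ⟨hj, hS₁ j h⟩)
  · rw [← spectrumAt_wordLift_zero_eq_zero_iff hα, hspec, if_neg]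
    simp
  · rintro rfl
    obtain ⟨j, hj⟩ := hns
    have := hspec j
    rw [if_pos (show j ∈ {j | ¬ IsSquare (φ j)} from hj)] at this
    simp [spectrumAt, wordLift] at this
  -- The index set of the inverse transform is invariant under adding `ℓ`, so each entry equals
  -- itself times `α ^ (-ℓ i)`. A nonzero entry forces `ℓ • i = 0`, which has at most `ℓ` solutions.
  · have hsupp : ∀ i, wordLift c i ≠ 0 → ℓ • i = 0 := by
      intro i hi
      have htr : wordLift c i = rootChar hα (-(ℓ * i)) * wordLift c i := by
        rw [hc, mul_left_comm]
        congr 1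
        rw [Finset.mul_sum]
        refine (Finset.sum_equiv (Equiv.addRight (ℓ : ZMod n)) (fun k => ?_) fun k _ => ?_).symm
        · simp
        · rw [← AddChar.map_add_eq_mul, Equiv.coe_addRight]
          congr 1
          ring
      have h1 : rootChar hα (-(ℓ * i)) = 1 :=
        mul_right_cancel₀ hi (htr.symm.trans (one_mul _).symm)
      rw [rootChar, AddChar.zmodChar_apply, hα.pow_eq_one_iff_dvd] at h1
      have h2 := Nat.eq_zero_of_dvd_of_lt h1 (ZMod.val_lt _)
      rw [ZMod.val_eq_zero, neg_eq_zero] at h2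
      rwa [nsmul_eq_mul]
    have hw : errorWeight c 0 = (Finset.univ.filter fun i => c i ≠ 0).card := by
      simp [errorWeight, Set.ncard_eq_toFinset_card']
    rw [hw, ← card_support_wordLift]
    refine (Finset.card_le_card fun i hi => ?_).trans
      (IsAddCyclic.card_nsmul_eq_zero_le (α := ZMod n) hℓ.pos)
    simpa using hsupp i (by simpa using hi)

/-- The square-root bound for odd-like words of weight `w`, in its general form and in the form
valid when the splitting is given by `-1`. -/
theorem square_root_bounds (hα : IsPrimitiveRoot α n) [DecidableEq F] {q : ℕ}
    {S₀ S₁ : Set (ZMod n)} {a : (ZMod n)ˣ} (hS : IsSplitting q n S₀ S₁ a) {c : Fin n → F}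
    (hsum : ∑ i, c i ≠ 0)
    (hc : (∀ j ∈ S₀, spectrumAt hα (wordLift c) j = 0) ∨
      ∀ j ∈ S₁, spectrumAt hα (wordLift c) (-j) = 0) :
    n ≤ (Finset.univ.filter fun i => c i ≠ 0).card ^ 2 ∧ ((a : ZMod n) = -1 →
      n + (Finset.univ.filter fun i => c i ≠ 0).card ≤
        (Finset.univ.filter fun i => c i ≠ 0).card ^ 2 + 1) := by
  classical
  have h0 : spectrumAt hα (wordLift c) 0 ≠ 0 :=
    (spectrumAt_wordLift_zero_eq_zero_iff hα c).not.2 hsum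
  have hcover : ∀ j : ZMod n, j ≠ 0 → j ∈ S₀ ∨ j ∈ S₁ := fun j hj => by
    have : j ∈ S₀ ∪ S₁ := hS.cover ▸ hj
    exact this
  obtain ⟨T, hT, hu⟩ : ∃ T : Set (ZMod n), (∀ j ∈ T, spectrumAt hα (wordLift c) j = 0) ∧
      ∀ j ≠ 0, j ∈ T ∨ ↑a⁻¹ * j ∈ T := by
    rcases hc with hc | hc
    · refine ⟨S₀, hc, fun j hj => (hcover j hj).imp_right fun h => ?_⟩
      rw [← hS.swap₀] at h
      obtain ⟨k, hk, rfl⟩ := h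
      simpa using hk
    -- The zero set `-S₁` is handled through `-S₀`, since the multiplier also maps `S₁` onto `S₀`.
    · refine ⟨{j | -j ∈ S₁}, fun j hj => by simpa using hc _ hj, fun j hj =>
        (hcover (-j) (neg_ne_zero.2 hj)).symm.imp_right fun h => ?_⟩
      rw [← hS.swap₁] at h
      obtain ⟨k, hk, hkj⟩ := h
      have : j = -(a * k) := by rw [← neg_eq_iff_eq_neg]; exact hkj.symm
      subst this
      simpa using hk
  rw [← card_support_wordLift]
  refine ⟨le_sq_card_support hα hT h0 a hu, fun ha => add_card_support_le hα hT h0 fun j hj => ?_⟩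
  have ha' : a = -1 := Units.ext (by simpa using ha)
  simpa [ha'] using hu j hj

end Duadic

theorem card_cast_ne_zero_of_coprime {F : Type*} [Field F] [Fintype F] {n : ℕ}
    (h : (Fintype.card F).Coprime n) : (n : F) ≠ 0 := by
  intro h0
  have := h.cast (R := F)
  rw [h0, FiniteField.cast_card_eq_zero, isCoprime_zero_left] at this
  exact not_isUnit_zero this

end DuadicQuantum

/-! ### The degenerate code -/

open DuadicQuantum in
theorem theorem4
    (p : ℕ) [Fact p.Prime] (F : Type*) [Field F] [Fintype F] [Algebra (ZMod p) F]
    (q : ℕ) (hq : Fintype.card F = q)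
    (ι : Type*) [Fintype ι] [Nonempty ι] (P m z : ι → ℕ)
    (hP : ∀ i, (P i).Prime) (hPinj : Function.Injective P)
    (n : ℕ) (hn : n = ∏ i, P i ^ m i) (hodd : Odd n) (hcop : Nat.Coprime q n)
    (hsq : ∀ i, IsSquare (q : ZMod (P i)))
    (hz : ∀ i, P i ^ z i ∣ q ^ orderOf (q : ZMod (P i)) - 1 ∧
      ¬ P i ^ (z i + 1) ∣ q ^ orderOf (q : ZMod (P i)) - 1)
    (hm : ∀ i, 2 * z i < m i) :
    ∃ (C D : Submodule F (Fin n → F)) (d d' : ℕ),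
      DuadicQuantum.IsDuadicPair C D ∧
      DuadicQuantum.IsCodeWithParams p (DuadicQuantum.cssCode p C D) 1 d ∧
      DuadicQuantum.IsDegenerate p (DuadicQuantum.cssCode p C D) d ∧
      IsGreatest {t | DuadicQuantum.PureTo p (DuadicQuantum.cssCode p C D) t} d' ∧
      d' ≤ Finset.univ.inf' Finset.univ_nonempty (fun i => P i ^ z i) ∧
      Finset.univ.inf' Finset.univ_nonempty (fun i => P i ^ z i) < d ∧
      n ≤ d ^ 2 ∧
      ((∀ i, (P i : ℤ) ≡ -1 [ZMOD 4]) → (n : ℤ) ≤ (d : ℤ) ^ 2 - d + 1) := by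
  classical
  subst hq
  have hnpos : 0 < n := hodd.pos
  have : NeZero n := ⟨hnpos.ne'⟩
  have hpow : ∀ i, P i ^ m i ∣ n := fun i => hn ▸ Finset.dvd_prod_of_mem _ (Finset.mem_univ i)
  have hdvd : ∀ i, P i ∣ n := fun i =>
    (dvd_pow_self _ (Nat.ne_of_gt (lt_of_le_of_lt (Nat.zero_le _) (hm i)))).trans (hpow i)
  have hprime : ∀ ℓ : ℕ, ℓ.Prime → ℓ ∣ n → ∃ i, P i = ℓ := by
    intro ℓ hℓ h
    rw [hn, hℓ.prime.dvd_finsetProd_iff] at h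
    obtain ⟨i, -, hi⟩ := h
    exact ⟨i, ((Nat.prime_dvd_prime_iff_eq hℓ (hP i)).1 (hℓ.dvd_of_dvd_pow hi)).symm⟩
  -- By definition of the order, `P i` divides `q ^ t - 1`, so the exact exponent is positive.
  have hzpos : ∀ i, 1 ≤ z i := by
    intro i
    by_contra! h
    have h0 : z i = 0 := by omega
    have : Fact (P i).Prime := ⟨hP i⟩
    refine (hz i).2 ?_
    rw [h0, zero_add, pow_one, ← Nat.modEq_iff_dvd' (Nat.one_le_pow _ _ Fintype.card_pos),
      ← ZMod.natCast_eq_natCast_iff, Nat.cast_one, Nat.cast_pow, pow_orderOf_eq_one]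
  have hnF : (n : F) ≠ 0 := card_cast_ne_zero_of_coprime hcop
  have : NeZero (n : AlgebraicClosure F) :=
    ⟨by rw [← map_natCast (algebraMap F (AlgebraicClosure F))]; exact (map_ne_zero _).2 hnF⟩
  obtain ⟨α, hα⟩ := HasEnoughRootsOfUnity.exists_primitiveRoot (AlgebraicClosure F) n
  obtain ⟨i₀, -, hi₀⟩ := Finset.exists_mem_eq_inf' (Finset.univ_nonempty (α := ι))
    (fun i => P i ^ z i)
  obtain ⟨w, hw, hwneg⟩ := exists_nonresidue hP hPinj
    (fun i h => by
      have := hdvd i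
      rw [h] at this
      exact (Nat.not_even_iff_odd.2 hodd) (even_iff_two_dvd.2 this)) hnpos hdvd
  have hwn : w.Coprime n := Nat.Coprime.symm <| Nat.coprime_of_dvd fun ℓ hℓ h₁ h₂ => by
    obtain ⟨i, rfl⟩ := hprime ℓ hℓ h₁
    exact hw i (by rw [(ZMod.natCast_eq_zero_iff _ _).2 h₂]; exact IsSquare.zero)
  obtain ⟨S₀, S₁, hS, hns⟩ := exists_isSplitting (hP i₀) (hdvd i₀) hcop hwn
    (fun ℓ hℓ h => by obtain ⟨i, rfl⟩ := hprime ℓ hℓ h; exact hsq i)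
    (fun ℓ hℓ h => by obtain ⟨i, rfl⟩ := hprime ℓ hℓ h; exact hw i)
  have h0 : (0 : ZMod n) ∉ S₀ ∪ S₁ := by
    rw [hS.cover]
    simp
  rw [Set.mem_union, not_or] at h0
  set D : Submodule F (Fin n → F) := cyclicCode α S₀ with hD
  have h1 : (fun _ => 1) ∈ D := const_one_mem_cyclicCode hα h0.1
  -- purity
  obtain ⟨c, hcC, hc0, hcw⟩ := exists_low_weight_word hα hcop hnF (hP i₀) (hdvd i₀) (hsq i₀)
    hS.disjoint ⟨w, by simpa using hw i₀⟩ hns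
  have hpure : ∀ t, PureTo p (cssCode p (evenLikeSubcode D) D) t → t ≤ P i₀ ^ z i₀ := fun t ht =>
    ((le_errorWeight_of_pureTo p hnF h1 hcC hc0 ht).trans hcw).trans
      (Nat.le_self_pow (Nat.ne_of_gt (hzpos i₀)) _)
  -- distance
  let R : ℕ → Prop := fun t => n ≤ t ^ 2 ∧ ((w : ZMod n) = -1 → n + t ≤ t ^ 2 + 1)
  have hRmono : ∀ {s t}, R s → s ≤ t → R t := by
    intro s t hs hst
    have hsq : s ^ 2 ≤ t ^ 2 := Nat.pow_le_pow_left hst 2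
    refine ⟨hs.1.trans hsq, fun h => ?_⟩
    have h2 := hs.2 h
    obtain ⟨k, rfl⟩ := Nat.exists_eq_add_of_le hst
    have hs1 : 1 ≤ s := Nat.one_le_iff_ne_zero.2 fun h => by
      have := hs.1
      simp [h] at this
      omega
    nlinarith
  have hRn : R n := ⟨Nat.le_self_pow two_ne_zero n, fun _ => by nlinarith⟩
  have hRex : ∃ t, R t := ⟨n, hRn⟩
  -- An undetected error would have a component whose weight satisfies `R`, so nothing lighter than
  -- the least such number escapes detection.
  have hdet : DetectsBelow p (cssCode p (evenLikeSubcode D) D) (Nat.find hRex) := by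
    refine detectsBelow_cssCode p (fun a b hlt ha => ⟨ha, ?_⟩) fun a b hlt hb => ?_
    · by_contra hsum
      refine Nat.find_min hRex hlt (hRmono ?_ (card_support_le_errorWeight_left a b))
      exact square_root_bounds hα hS hsum (Or.inl ((mem_cyclicCode_iff hα).1 ha))
    · by_contra hbD
      refine Nat.find_min hRex hlt (hRmono ?_ (card_support_le_errorWeight_right a b))
      exact square_root_bounds hα hS (sum_ne_zero_of_mem_dualCode hnF h1 hb hbD)
        (Or.inr fun j hj => spectrumAt_neg_of_mem_dualCode hα hcop hnF hS.closed₁ hS.disjoint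
          h0.2 hb hj)
  have hexists : ∀ {s : Set ℕ} {a b : ℕ}, a ∈ s → (∀ t ∈ s, t ≤ b) →
      ∃ g, IsGreatest s g := fun {s a b} ha hb =>
    ⟨sSup s, Nat.sSup_mem ⟨a, ha⟩ ⟨b, hb⟩, fun t ht => le_csSup ⟨b, hb⟩ ht⟩
  obtain ⟨d, hd⟩ := hexists (s := {t | DetectsBelow p (cssCode p (evenLikeSubcode D) D) t})
    hdet (fun t ht => not_lt.1 fun h => not_detectsBelow_cssCode p hnF h1 h ht)
  obtain ⟨d', hd'⟩ := hexists (s := {t | PureTo p (cssCode p (evenLikeSubcode D) D) t})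
    -- Purity to `0` is vacuous, so the set is nonempty; the light word bounds it.
    (a := 0) (fun _ _ h => absurd h (Nat.not_lt_zero _)) hpure
  have hRd : R d := hRmono (Nat.find_spec hRex) (hd.2 hdet)
  -- Compare squares: `p₀ ^ (2z) < p₀ ^ m ≤ n ≤ d ^ 2`.
  have hlt : P i₀ ^ z i₀ < d := by
    refine lt_of_pow_lt_pow_left₀ 2 (Nat.zero_le _) (lt_of_lt_of_le ?_ hRd.1)
    refine lt_of_lt_of_le ?_ (Nat.le_of_dvd hnpos (hpow i₀))
    rw [← pow_mul, mul_comm]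
    exact Nat.pow_lt_pow_right (hP i₀).one_lt (hm i₀)
  refine ⟨evenLikeSubcode D, D, d, d', ⟨α, S₀, S₁, _, hα, hS, rfl, rfl⟩,
    ⟨isStabilizerCode_cssCode p fun c hc => hc.1, ?_, hd⟩,
    fun h => (hpure d h).not_gt hlt, hd', ?_, ?_, hRd.1, fun h => ?_⟩
  · rw [finrank_cssCode p hnF h1, pow_one]
  · rw [hi₀]
    exact hpure _ hd'.1
  · rwa [hi₀]
  · have := hRd.2 (hwneg h)
    zify at this
    linarith
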